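/- Let $H$ be a real Hilbert space and let $K(H)$ be the space of all compact linear operators $H\to H$ with the operator norm. For $T,A\in K(H)$ put \[ \rho'_{\pm}(T,A)=\lim_{t\to 0^{\pm}}\|T\|\,\frac{\|T+tA\|-\|T\|}{t} \] (these limits always exist), and let $M_T=\{x\in H:\|x\|=1,\ \|Tx\|=\|T\|\}$. Let $T\in K(H)$ be nonzero. Then the following are equivalent: (i) $T$ is $\rho_+$-smooth in $K(H)$, i.e. $\rho'_+(T,A+B)=\rho'_+(T,A)+\rho'_+(T,B)$ for all $A,B\in K(H)$; (ii) $T$ is $\rho_-$-smooth in $K(H)$, i.e. $\rho'_-(T,A+B)=\rho'_-(T,A)+\rho'_-(T,B)$ for all $A,B\in K(H)$; (iii) $T$ is a smooth point of $K(H)$, i.e. there is exactly one bounded linear functional $f$ on $K(H)$ with $\|f\|=1$ and $f(T)=\|T\|$; (iv) $M_T=\{x_0,-x_0\}$ for some $x_0\in H$ with $\|x_0\|=1$. -/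

import Mathlib

open Filter Topology

noncomputable section

namespace NormDerivatives

variable {X : Type*} [NormedAddCommGroup X] [NormedSpace ℝ X]

/-- The quotient `‖x‖ (‖x + t y‖ - ‖x‖) / t` whose one-sided limits at `t = 0` are the
norm derivatives. -/
def normQuotient (x y : X) (t : ℝ) : ℝ :=
  ‖x‖ * ((‖x + t • y‖ - ‖x‖) / t)

/-- The right norm derivative `ρ'₊(x, y)`, the limit of `normQuotient x y t` as `t → 0+`.
The limit always exists, see `tendsto_rhoPlus`. -/
def rhoPlus (x y : X) : ℝ :=
  limUnder (𝓝[>] (0 : ℝ)) (normQuotient x y)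

/-- The left norm derivative `ρ'₋(x, y)`, the limit of `normQuotient x y t` as `t → 0-`.
The limit always exists, see `tendsto_rhoMinus`. -/
def rhoMinus (x y : X) : ℝ :=
  limUnder (𝓝[<] (0 : ℝ)) (normQuotient x y)

theorem convexOn_norm_line (x y : X) :
    ConvexOn ℝ Set.univ (fun t : ℝ => ‖x + t • y‖) := by
  have h := (convexOn_univ_norm (E := X)).comp_affineMap (AffineMap.lineMap x (x + y) : ℝ →ᵃ[ℝ] X)
  simpa [Function.comp_def, AffineMap.lineMap_apply, add_comm] using h

/-- The limit defining `ρ'₊(x, y)` exists. -/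
theorem tendsto_rhoPlus (x y : X) :
    Tendsto (normQuotient x y) (𝓝[>] (0 : ℝ)) (𝓝 (rhoPlus x y)) := by
  have h := (hasDerivWithinAt_iff_tendsto_slope' (by simp)).mp
    ((convexOn_norm_line x y).hasDerivWithinAt_rightDeriv_of_mem_interior
      (x := 0) (by simp))
  refine tendsto_nhds_limUnder ⟨_, (h.const_mul ‖x‖).congr fun t => ?_⟩
  simp [normQuotient, slope_def_field]

/-- The limit defining `ρ'₋(x, y)` exists. -/
theorem tendsto_rhoMinus (x y : X) :
    Tendsto (normQuotient x y) (𝓝[<] (0 : ℝ)) (𝓝 (rhoMinus x y)) := by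
  have h := (hasDerivWithinAt_iff_tendsto_slope' (by simp)).mp
    ((convexOn_norm_line x y).hasDerivWithinAt_leftDeriv_of_mem_interior
      (x := 0) (by simp))
  refine tendsto_nhds_limUnder ⟨_, (h.const_mul ‖x‖).congr fun t => ?_⟩
  simp [normQuotient, slope_def_field]

/-- A nonzero vector `x` is `ρ₊`-smooth if `ρ'₊(x, ·) : X → ℝ` is additive. -/
def IsRhoPlusSmooth (x : X) : Prop :=
  x ≠ 0 ∧ ∀ y z : X, rhoPlus x (y + z) = rhoPlus x y + rhoPlus x z

/-- A nonzero vector `x` is `ρ₋`-smooth if `ρ'₋(x, ·) : X → ℝ` is additive. -/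
def IsRhoMinusSmooth (x : X) : Prop :=
  x ≠ 0 ∧ ∀ y z : X, rhoMinus x (y + z) = rhoMinus x y + rhoMinus x z

/-- The set `J(x)` of support functionals at `x`: the norm-one elements `f` of the dual space
with `f x = ‖x‖`. -/
def supportFunctionals (x : X) : Set (StrongDual ℝ X) :=
  {f | ‖f‖ = 1 ∧ f x = ‖x‖}

/-- `x` is a smooth point of `X` if it has exactly one support functional. -/
def IsSmoothPoint (x : X) : Prop :=
  ∃ f : StrongDual ℝ X, supportFunctionals x = {f}

/-- The norm attainment set `M_T` of a bounded operator. -/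
def normAttainmentSet {Y : Type*} [NormedAddCommGroup Y] [NormedSpace ℝ Y]
    (T : X →L[ℝ] Y) : Set X :=
  {x | ‖x‖ = 1 ∧ ‖T x‖ = ‖T‖}

end NormDerivatives

end

open scoped InnerProductSpace

namespace NormDerivatives

/-! ### Norm derivatives and support functionals in a normed space -/

section NormedSpace

variable {X : Type*} [NormedAddCommGroup X] [NormedSpace ℝ X]

/-! The two one-sided conditions are exchanged by `t ↦ -t`. Every support functional `f` at `T`
satisfies `‖T‖ f ≤ ρ'₊(T, ·)`, so additivity of `ρ'₊` forces equality and determines `f`. Each `x ∈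
M_T` yields the support functional `A ↦ ⟪T x, A x⟫ / ‖T‖`. Rank-one operators tell these functionals
apart up to the sign of `x`, and compactness makes `M_T` nonempty, so smoothness gives `M_T = {x₀,
-x₀}`. Conversely, `exists_rhoPlus_le_inner` bounds `ρ'₊(T, A)` by `⟪T z, A z⟫` with `z ∈ M_T`. If
`M_T = {x₀, -x₀}`, this meets the lower bound from the support functional at `x₀`, so `ρ'₊(T, ·)` is
linear. -/

theorem rhoMinus_eq_neg_rhoPlus_neg (x y : X) : rhoMinus x y = -rhoPlus x (-y) := by
  have hneg : Tendsto (fun t : ℝ => -t) (𝓝[>] 0) (𝓝[<] 0) := by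
    have h := tendsto_neg_nhdsGT (a := (0 : ℝ))
    rwa [neg_zero] at h
  refine tendsto_nhds_unique ((tendsto_rhoMinus x y).comp hneg)
    ((tendsto_rhoPlus x (-y)).neg.congr fun t => ?_)
  simp [normQuotient, div_neg]

theorem isRhoPlusSmooth_iff_isRhoMinusSmooth (x : X) :
    IsRhoPlusSmooth x ↔ IsRhoMinusSmooth x := by
  refine and_congr_right fun _ => ⟨fun h y z => ?_, fun h y z => ?_⟩
  · simp only [rhoMinus_eq_neg_rhoPlus_neg, neg_add, h]
  · have h' := h (-y) (-z)
    simp only [rhoMinus_eq_neg_rhoPlus_neg, neg_add, neg_neg] at h'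
    linarith

theorem norm_mul_apply_le_rhoPlus {x : X} {f : StrongDual ℝ X} (hf : ‖f‖ ≤ 1)
    (hfx : f x = ‖x‖) (y : X) : ‖x‖ * f y ≤ rhoPlus x y := by
  refine ge_of_tendsto (tendsto_rhoPlus x y) ?_
  filter_upwards [self_mem_nhdsWithin] with t ht
  have h := (le_abs_self _).trans (f.le_of_opNorm_le hf (x + t • y))
  rw [map_add, map_smul, hfx, smul_eq_mul, one_mul] at h
  refine mul_le_mul_of_nonneg_left ?_ (norm_nonneg x)
  rw [le_div_iff₀ ht]
  linarith

theorem exists_mem_supportFunctionals_of_abs_le {x : X} (hx : x ≠ 0) {g : X → ℝ}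
    (hadd : ∀ y z, g (y + z) = g y + g z) (hsmul : ∀ (c : ℝ) y, g (c • y) = c * g y)
    (hle : ∀ y, |g y| ≤ ‖y‖) (hgx : g x = ‖x‖) :
    ∃ f ∈ supportFunctionals x, ∀ y, f y = g y := by
  let l : X →ₗ[ℝ] ℝ := { toFun := g, map_add' := hadd, map_smul' := hsmul }
  have hl (y : X) : ‖l y‖ ≤ 1 * ‖y‖ := (hle y).trans_eq (one_mul _).symm
  refine ⟨l.mkContinuous 1 hl, ⟨(l.mkContinuous_norm_le zero_le_one hl).antisymm ?_, hgx⟩,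
    fun _ => rfl⟩
  have h : ‖x‖ ≤ ‖l.mkContinuous 1 hl‖ * ‖x‖ := by
    calc ‖x‖ = l.mkContinuous 1 hl x := hgx.symm
      _ ≤ _ := (le_abs_self _).trans ((l.mkContinuous 1 hl).le_opNorm x)
  exact le_of_mul_le_mul_right (by simpa using h) (norm_pos_iff.mpr hx)

/-- Additivity makes `rhoPlus x` odd, so applying the bound `‖x‖ f ≤ rhoPlus x` at `y` and `-y`
gives equality. -/
theorem IsRhoPlusSmooth.isSmoothPoint {x : X} (h : IsRhoPlusSmooth x) : IsSmoothPoint x := by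
  obtain ⟨hx, hadd⟩ := h
  have hpos : 0 < ‖x‖ := norm_pos_iff.mpr hx
  have hneg (y : X) : rhoPlus x (-y) = -rhoPlus x y := by
    have h0 : rhoPlus x 0 = 0 := by simpa using hadd 0 0
    have h1 := hadd y (-y)
    rw [add_neg_cancel, h0] at h1
    linarith
  have hval (f : StrongDual ℝ X) (hf : f ∈ supportFunctionals x) (y : X) :
      ‖x‖ * f y = rhoPlus x y := by
    have h1 := norm_mul_apply_le_rhoPlus hf.1.le hf.2 y
    have h2 := norm_mul_apply_le_rhoPlus hf.1.le hf.2 (-y)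
    rw [map_neg, hneg] at h2
    linarith
  obtain ⟨f, hf, hfx⟩ := exists_dual_vector ℝ x hpos.ne'
  have hfmem : f ∈ supportFunctionals x := ⟨hf, by simpa using hfx⟩
  refine ⟨f, Set.eq_singleton_iff_unique_mem.mpr ⟨hfmem, fun g hg => ?_⟩⟩
  ext y
  exact mul_left_cancel₀ hpos.ne' ((hval g hg y).trans (hval f hfmem y).symm)

end NormedSpace

/-! ### Support functionals from norm-attaining vectors -/

section Hilbert

variable {H : Type*} [NormedAddCommGroup H] [InnerProductSpace ℝ H]

/-- If `T` attains its norm at the unit vector `x`, then `A ↦ ⟪T x, A x⟫ / ‖T‖` is a support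
functional at `T`. -/
theorem exists_mem_supportFunctionals_apply_eq_inner
    {T : compactOperator (RingHom.id ℝ) H H} (hT : T ≠ 0)
    {x : H} (hx : x ∈ normAttainmentSet (T : H →L[ℝ] H)) :
    ∃ f ∈ supportFunctionals T, ∀ A : compactOperator (RingHom.id ℝ) H H,
      ‖T‖ * f A = ⟪(T : H →L[ℝ] H) x, (A : H →L[ℝ] H) x⟫_ℝ := by
  have hpos : 0 < ‖T‖ := norm_pos_iff.mpr hT
  have hTx : ‖(T : H →L[ℝ] H) x‖ = ‖T‖ := hx.2
  have hle (A : compactOperator (RingHom.id ℝ) H H) :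
      |‖T‖⁻¹ * ⟪(T : H →L[ℝ] H) x, (A : H →L[ℝ] H) x⟫_ℝ| ≤ ‖A‖ := by
    have hA : ‖(A : H →L[ℝ] H) x‖ ≤ ‖A‖ := (A : H →L[ℝ] H).unit_le_opNorm x hx.1.le
    rw [abs_mul, abs_of_pos (inv_pos.mpr hpos), inv_mul_le_iff₀ hpos, ← hTx]
    exact (abs_real_inner_le_norm _ _).trans (mul_le_mul_of_nonneg_left hA (norm_nonneg _))
  obtain ⟨f, hf, hfA⟩ := exists_mem_supportFunctionals_of_abs_le hT
    (g := fun A => ‖T‖⁻¹ * ⟪(T : H →L[ℝ] H) x, (A : H →L[ℝ] H) x⟫_ℝ)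
    (fun A B => by simp [inner_add_right, mul_add])
    (fun c A => by simp [real_inner_smul_right, mul_left_comm]) hle
    (by
      simp only [real_inner_self_eq_norm_mul_norm, hTx, inv_mul_cancel_left₀ hpos.ne']
      rfl)
  exact ⟨f, hf, fun A => by rw [hfA, mul_inv_cancel_left₀ hpos.ne']⟩

theorem isCompactOperator_rankOne (w u : H) :
    IsCompactOperator (InnerProductSpace.rankOne ℝ w u : H →L[ℝ] H) := by
  rw [InnerProductSpace.rankOne_def']
  exact (isCompactOperator_of_locallyCompactSpace_rng
    (ContinuousLinearMap.toSpanSingleton ℝ w)).comp_clm (innerSL ℝ u)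

/-- Testing with `A = ⟪u, ·⟫ T y` for `u ⊥ x` gives `‖T y‖² ⟪u, y⟫ = 0`; hence `y` lies on the line
through `x`. -/
theorem eq_or_eq_neg_of_forall_inner_eq {T : compactOperator (RingHom.id ℝ) H H}
    (hT : T ≠ 0) {x y : H} (hx : x ∈ normAttainmentSet (T : H →L[ℝ] H))
    (hy : y ∈ normAttainmentSet (T : H →L[ℝ] H))
    (h : ∀ A : compactOperator (RingHom.id ℝ) H H,
      ⟪(T : H →L[ℝ] H) x, (A : H →L[ℝ] H) x⟫_ℝ = ⟪(T : H →L[ℝ] H) y, (A : H →L[ℝ] H) y⟫_ℝ) :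
    y = x ∨ y = -x := by
  have hTy : (T : H →L[ℝ] H) y ≠ 0 := by
    rw [← norm_ne_zero_iff, hy.2]
    exact norm_ne_zero_iff.mpr fun h => hT (Subtype.ext h)
  have key (u : H) (hu : ⟪u, x⟫_ℝ = 0) : ⟪u, y⟫_ℝ = 0 := by
    have h1 := h ⟨InnerProductSpace.rankOne ℝ ((T : H →L[ℝ] H) y) u,
      isCompactOperator_rankOne _ _⟩
    simpa [inner_smul_right, hu, hTy] using h1
  have hxx : ⟪x, x⟫_ℝ = 1 := by simp [hx.1]
  have horth : ⟪y - ⟪x, y⟫_ℝ • x, x⟫_ℝ = 0 := by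
    rw [inner_sub_left, real_inner_smul_left, hxx, real_inner_comm]
    ring
  -- This vector is orthogonal to `x`, hence by `key` to `y`, hence to itself.
  have h0 : y - ⟪x, y⟫_ℝ • x = 0 := by
    rw [← inner_self_eq_zero (𝕜 := ℝ), inner_sub_right (𝕜 := ℝ) (y - _), key _ horth,
      real_inner_smul_right, horth]
    ring
  have hyx : y = ⟪x, y⟫_ℝ • x := sub_eq_zero.mp h0
  have habs : |⟪x, y⟫_ℝ| = 1 := by
    have h1 := congrArg norm hyx
    rw [norm_smul, hx.1, hy.1, mul_one] at h1
    exact h1.symm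
  rcases eq_or_eq_neg_of_abs_eq habs with hc | hc
  · left; rwa [hc, one_smul] at hyx
  · right; rwa [hc, neg_one_smul] at hyx

/-! ### Compactness and the upper bound for the right derivative -/

variable [CompleteSpace H]

/-- A norm-maximizing sequence of a nonzero compact operator has a subsequence converging to a
point where the norm is attained. -/
theorem exists_subseq_tendsto_mem_normAttainmentSet {T : H →L[ℝ] H} (hT : IsCompactOperator T)
    (hT0 : T ≠ 0) {x : ℕ → H} (hx : ∀ n, ‖x n‖ ≤ 1)
    (hlim : Tendsto (fun n => ‖T (x n)‖) atTop (𝓝 ‖T‖)) :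
    ∃ z ∈ normAttainmentSet T, ∃ φ : ℕ → ℕ, StrictMono φ ∧ Tendsto (x ∘ φ) atTop (𝓝 z) := by
  have hpos : 0 < ‖T‖ := norm_pos_iff.mpr hT0
  have hcpt : IsCompact (closure (T '' Metric.closedBall 0 1)) :=
    hT.isCompact_closure_image_closedBall (f := (T : H →ₗ[ℝ] H)) 1
  obtain ⟨y, -, φ, hφ, hy⟩ := hcpt.tendsto_subseq (x := fun n => T (x n)) fun n =>
    subset_closure ⟨x n, by simpa using hx n, rfl⟩
  have hyn : ‖y‖ = ‖T‖ := tendsto_nhds_unique hy.norm (hlim.comp hφ.tendsto_atTop)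
  -- A norm-attaining `z` satisfies `T* T z = ‖T‖² z`, so with `T z = y` this is the only candidate
  -- for the limit.
  set z : H := (‖T‖ ^ 2)⁻¹ • ContinuousLinearMap.adjoint T y with hz
  have hzn : ‖z‖ ≤ 1 := by
    have h1 := (ContinuousLinearMap.adjoint T).le_opNorm y
    rw [LinearIsometryEquiv.norm_map, hyn] at h1
    rw [hz, norm_smul, norm_inv, norm_pow, norm_norm, inv_mul_le_iff₀ (by positivity)]
    linarith
  have hinner : Tendsto (fun n => ⟪x (φ n), z⟫_ℝ) atTop (𝓝 1) := by
    have h1 : Tendsto (fun n => (‖T‖ ^ 2)⁻¹ * ⟪T (x (φ n)), y⟫_ℝ) atTop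
        (𝓝 ((‖T‖ ^ 2)⁻¹ * ⟪y, y⟫_ℝ)) :=
      (hy.inner tendsto_const_nhds).const_mul _
    rw [real_inner_self_eq_norm_sq, hyn, inv_mul_cancel₀ (by positivity)] at h1
    refine h1.congr fun n => ?_
    rw [hz, real_inner_smul_right, ContinuousLinearMap.adjoint_inner_right]
  -- In the unit ball, inner products tending to `1` force norm convergence.
  have hsq : Tendsto (fun n => ‖x (φ n) - z‖ ^ 2) atTop (𝓝 0) := by
    have h1 : Tendsto (fun n => 2 - 2 * ⟪x (φ n), z⟫_ℝ) atTop (𝓝 0) := by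
      simpa using (hinner.const_mul 2).const_sub 2
    refine squeeze_zero (fun n => by positivity) (fun n => ?_) h1
    rw [norm_sub_sq_real]
    have h2 := pow_le_one₀ (n := 2) (norm_nonneg _) (hx (φ n))
    have h3 := pow_le_one₀ (n := 2) (norm_nonneg _) hzn
    linarith
  have hxz : Tendsto (x ∘ φ) atTop (𝓝 z) := by
    rw [tendsto_iff_norm_sub_tendsto_zero]
    simpa [Real.sqrt_sq] using hsq.sqrt
  have hTz : ‖T z‖ = ‖T‖ := by
    rw [tendsto_nhds_unique ((T.continuous.tendsto z).comp hxz) hy, hyn]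
  refine ⟨z, ⟨hzn.antisymm ?_, hTz⟩, φ, hφ, hxz⟩
  have h1 := T.le_opNorm z
  rw [hTz] at h1
  exact le_of_mul_le_mul_left (by simpa using h1) hpos

theorem normAttainmentSet_nonempty {T : H →L[ℝ] H} (hT : IsCompactOperator T) (hT0 : T ≠ 0) :
    (normAttainmentSet T).Nonempty := by
  have hex (n : ℕ) : ∃ x : H, ‖x‖ < 1 ∧ ‖T‖ - 1 / ((n : ℝ) + 1) < ‖T x‖ :=
    T.exists_lt_apply_of_lt_opNorm (sub_lt_self _ (by positivity))
  choose x hx hTx using hex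
  have hlim : Tendsto (fun n => ‖T (x n)‖) atTop (𝓝 ‖T‖) := by
    refine tendsto_of_tendsto_of_tendsto_of_le_of_le ?_ tendsto_const_nhds
      (fun n => (hTx n).le) fun n => T.unit_le_opNorm _ (hx n).le
    simpa using (tendsto_one_div_add_atTop_nhds_zero_nat (𝕜 := ℝ)).const_sub ‖T‖
  obtain ⟨z, hz, -⟩ := exists_subseq_tendsto_mem_normAttainmentSet hT hT0 (fun n => (hx n).le) hlim
  exact ⟨z, hz⟩

theorem IsSmoothPoint.exists_normAttainmentSet_eq {T : compactOperator (RingHom.id ℝ) H H}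
    (hT : T ≠ 0) (h : IsSmoothPoint T) :
    ∃ x₀ : H, ‖x₀‖ = 1 ∧ normAttainmentSet (T : H →L[ℝ] H) = {x₀, -x₀} := by
  obtain ⟨f, hf⟩ := h
  have hT0 : (T : H →L[ℝ] H) ≠ 0 := by simpa using hT
  obtain ⟨x, hx⟩ := normAttainmentSet_nonempty T.2 hT0
  have heq (y : H) (hy : y ∈ normAttainmentSet (T : H →L[ℝ] H))
      (A : compactOperator (RingHom.id ℝ) H H) :
      ‖T‖ * f A = ⟪(T : H →L[ℝ] H) y, (A : H →L[ℝ] H) y⟫_ℝ := by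
    obtain ⟨g, hg, hgA⟩ := exists_mem_supportFunctionals_apply_eq_inner hT hy
    rw [hf] at hg
    rw [← hgA, Set.mem_singleton_iff.mp hg]
  refine ⟨x, hx.1, Set.Subset.antisymm (fun y hy => ?_) ?_⟩
  · exact eq_or_eq_neg_of_forall_inner_eq hT hx hy fun A =>
      (heq x hx A).symm.trans (heq y hy A)
  · rintro y (rfl | rfl)
    · exact hx
    · exact ⟨by rw [norm_neg, hx.1], by rw [map_neg, norm_neg, hx.2]⟩

/-- The right norm derivative at `T` in direction `A` is at most `⟪T z, A z⟫` for some `z` in the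
norm attainment set of `T`. -/
theorem exists_rhoPlus_le_inner {T : compactOperator (RingHom.id ℝ) H H} (hT : T ≠ 0)
    (A : compactOperator (RingHom.id ℝ) H H) :
    ∃ z ∈ normAttainmentSet (T : H →L[ℝ] H),
      rhoPlus T A ≤ ⟪(T : H →L[ℝ] H) z, (A : H →L[ℝ] H) z⟫_ℝ := by
  have hT0 : (T : H →L[ℝ] H) ≠ 0 := by simpa using hT
  set t : ℕ → ℝ := fun n => 1 / ((n : ℝ) + 1)
  have htpos (n : ℕ) : 0 < t n := by positivity
  have ht0 : Tendsto t atTop (𝓝 0) := tendsto_one_div_add_atTop_nhds_zero_nat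
  have htw : Tendsto t atTop (𝓝[>] 0) :=
    tendsto_nhdsWithin_iff.mpr ⟨ht0, Eventually.of_forall htpos⟩
  have hex (n : ℕ) : ∃ x : H, ‖x‖ ≤ 1 ∧ ‖(T + t n • A : H →L[ℝ] H) x‖ = ‖T + t n • A‖ := by
    by_cases h0 : T + t n • A = 0
    -- The perturbed operator may vanish; only `‖x‖ ≤ 1` is needed below, so `0` serves.
    · exact ⟨0, by simp, by simp [h0]⟩
    · obtain ⟨x, hx⟩ := normAttainmentSet_nonempty (T + t n • A).2 fun h => h0 (Subtype.ext h)
      exact ⟨x, hx.1.le, hx.2⟩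
  choose x hx hxn using hex
  have hAx (n : ℕ) : ‖(A : H →L[ℝ] H) (x n)‖ ≤ ‖A‖ := (A : H →L[ℝ] H).unit_le_opNorm _ (hx n)
  have hTx (n : ℕ) : ‖(T : H →L[ℝ] H) (x n)‖ ≤ ‖T‖ := (T : H →L[ℝ] H).unit_le_opNorm _ (hx n)
  have hnorm : Tendsto (fun n => ‖T + t n • A‖) atTop (𝓝 ‖T‖) := by
    simpa using (tendsto_const_nhds.add (ht0.smul_const A)).norm (f := fun n => T + t n • A)
  have hlim : Tendsto (fun n => ‖(T : H →L[ℝ] H) (x n)‖) atTop (𝓝 ‖T‖) := by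
    have h1 : Tendsto (fun n => ‖T + t n • A‖ - t n * ‖A‖) atTop (𝓝 ‖T‖) := by
      simpa using hnorm.sub (ht0.mul_const ‖A‖)
    refine tendsto_of_tendsto_of_tendsto_of_le_of_le h1 tendsto_const_nhds (fun n => ?_) hTx
    have h2 := norm_add_le ((T : H →L[ℝ] H) (x n)) (t n • (A : H →L[ℝ] H) (x n))
    rw [norm_smul, Real.norm_of_nonneg (htpos n).le] at h2
    have h3 := mul_le_mul_of_nonneg_left (hAx n) (htpos n).le
    have h4 : ‖(T : H →L[ℝ] H) (x n) + t n • (A : H →L[ℝ] H) (x n)‖ = ‖T + t n • A‖ := hxn n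
    simp only
    linarith
  obtain ⟨z, hz, φ, hφ, hxz⟩ :=
    exists_subseq_tendsto_mem_normAttainmentSet T.2 hT0 hx hlim
  refine ⟨z, hz, ?_⟩
  have hφt := hφ.tendsto_atTop
  have hpos : 0 < ‖T‖ := norm_pos_iff.mpr hT
  -- The factor `‖T + tA‖ + ‖T‖` turns the quotient into a difference of squares, which the inner
  -- product can expand.
  have hleft : Tendsto (fun n => (‖T + t (φ n) • A‖ + ‖T‖) *
      ((‖T + t (φ n) • A‖ - ‖T‖) / t (φ n))) atTop (𝓝 (2 * rhoPlus T A)) := by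
    have h1 := (((hnorm.comp hφt).add_const ‖T‖).mul
      ((((tendsto_rhoPlus T A).comp htw).comp hφt).const_mul ‖T‖⁻¹))
    have h2 : (‖T‖ + ‖T‖) * (‖T‖⁻¹ * rhoPlus T A) = 2 * rhoPlus T A := by
      field_simp
      ring
    rw [h2] at h1
    refine h1.congr fun n => ?_
    simp only [Function.comp_apply, normQuotient]
    rw [inv_mul_cancel_left₀ hpos.ne']
  have hright : Tendsto (fun n => 2 * ⟪(T : H →L[ℝ] H) (x (φ n)), (A : H →L[ℝ] H) (x (φ n))⟫_ℝ +
      t (φ n) * ‖A‖ ^ 2) atTop (𝓝 (2 * ⟪(T : H →L[ℝ] H) z, (A : H →L[ℝ] H) z⟫_ℝ)) := by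
    have h1 := ((((T : H →L[ℝ] H).continuous.tendsto z).comp hxz).inner
      (((A : H →L[ℝ] H).continuous.tendsto z).comp hxz) (𝕜 := ℝ)).const_mul 2
    simpa using h1.add ((ht0.comp hφt).mul_const (‖A‖ ^ 2))
  have hle := le_of_tendsto_of_tendsto' hleft hright fun n => by
    have hp := htpos (φ n)
    rw [← mul_div_assoc, div_le_iff₀ hp]
    have h1 : ‖T + t (φ n) • A‖ =
        ‖(T : H →L[ℝ] H) (x (φ n)) + t (φ n) • (A : H →L[ℝ] H) (x (φ n))‖ := (hxn (φ n)).symm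
    have h2 := norm_add_sq_real ((T : H →L[ℝ] H) (x (φ n))) (t (φ n) • (A : H →L[ℝ] H) (x (φ n)))
    rw [← h1, norm_smul, mul_pow, Real.norm_of_nonneg hp.le, real_inner_smul_right] at h2
    have h3 := pow_le_pow_left₀ (norm_nonneg _) (hTx (φ n)) 2
    have h4 := mul_le_mul_of_nonneg_left (pow_le_pow_left₀ (norm_nonneg _) (hAx (φ n)) 2)
      (sq_nonneg (t (φ n)))
    linarith
  linarith

theorem rhoPlus_eq_inner {T : compactOperator (RingHom.id ℝ) H H} (hT : T ≠ 0) {x₀ : H}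
    (h : normAttainmentSet (T : H →L[ℝ] H) = {x₀, -x₀})
    (A : compactOperator (RingHom.id ℝ) H H) :
    rhoPlus T A = ⟪(T : H →L[ℝ] H) x₀, (A : H →L[ℝ] H) x₀⟫_ℝ := by
  have hx : x₀ ∈ normAttainmentSet (T : H →L[ℝ] H) := by simp [h]
  refine le_antisymm ?_ ?_
  · obtain ⟨z, hz, hle⟩ := exists_rhoPlus_le_inner hT A
    rw [h] at hz
    rcases hz with rfl | rfl
    · exact hle
    · simpa using hle
  · obtain ⟨f, hf, hfA⟩ := exists_mem_supportFunctionals_apply_eq_inner hT hx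
    rw [← hfA]
    exact norm_mul_apply_le_rhoPlus hf.1.le hf.2 A

theorem isRhoPlusSmooth_of_normAttainmentSet_eq {T : compactOperator (RingHom.id ℝ) H H}
    (hT : T ≠ 0) {x₀ : H} (h : normAttainmentSet (T : H →L[ℝ] H) = {x₀, -x₀}) :
    IsRhoPlusSmooth T :=
  ⟨hT, fun A B => by simp [rhoPlus_eq_inner hT h, inner_add_right]⟩

end Hilbert

end NormDerivatives

theorem mainTheorem3 {H : Type*} [NormedAddCommGroup H] [InnerProductSpace ℝ H] [CompleteSpace H]
    (T : compactOperator (RingHom.id ℝ) H H) (hT : T ≠ 0) :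
    List.TFAE [
      NormDerivatives.IsRhoPlusSmooth T,
      NormDerivatives.IsRhoMinusSmooth T,
      NormDerivatives.IsSmoothPoint T,
      ∃ x₀ : H, ‖x₀‖ = 1 ∧
        NormDerivatives.normAttainmentSet (T : H →L[ℝ] H) = {x₀, -x₀}] := by
  tfae_have 1 ↔ 2 := NormDerivatives.isRhoPlusSmooth_iff_isRhoMinusSmooth T
  tfae_have 1 → 3 := fun h => h.isSmoothPoint
  tfae_have 3 → 4 := fun h => h.exists_normAttainmentSet_eq hT
  tfae_have 4 → 1 := fun ⟨_, _, h⟩ => NormDerivatives.isRhoPlusSmooth_of_normAttainmentSet_eq hT h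
  tfae_finish
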